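/- Let $t\in\mathbb{R}$ be fixed and let $w(x;t)=e^{-x^4+tx^2}$, $x\in\mathbb{R}$, be the quartic Freud weight. Let $P_n(x;t)$, $n=0,1,2,\dots$, be the monic polynomials with $\deg P_n=n$ that are orthogonal with respect to $w$, i.e. $\int_{-\infty}^{\infty}P_j(x;t)P_k(x;t)w(x;t)\,dx=h_j(t)\delta_{jk}$ with $h_j(t)>0$, and let $\beta_n(t)$ be the (uniquely determined) coefficients of their three-term recurrence relation $$xP_n(x;t)=P_{n+1}(x;t)+\beta_n(t)P_{n-1}(x;t)\quad(n\ge 1),\qquad xP_0(x;t)=P_1(x;t),\qquad \beta_0(t)=0.$$ These coefficients exist and are unique, and, as $n\to\infty$, $$\beta_n(t)=\frac{n^{1/2}}{2\sqrt3}+\frac{t}{12}+\frac{t^2}{48\sqrt3\,n^{1/2}}-\frac{t^4-48}{2304\sqrt3\,n^{3/2}}+\frac{t}{288\,n^2}+\frac{t^2(t^4-144)}{55296\sqrt3\,n^{5/2}}-\frac{t^3}{1728\,n^3}+O\big(n^{-7/2}\big),$$ where the implied constant may depend on $t$. -/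

import Mathlib

open Polynomial MeasureTheory Filter Asymptotics

/-- The quartic Freud weight `w(x; t) = exp (-x⁴ + t x²)` on the real line. -/
noncomputable def freudWeight (t x : ℝ) : ℝ :=
  Real.exp (-x ^ 4 + t * x ^ 2)

/-- `P 0, P 1, P 2, …` is the sequence of monic orthogonal polynomials, `P n` of degree `n`, for
the quartic Freud weight; `h j > 0` is the squared `L²`-norm of `P j`. -/
structure IsMonicFreudPolynomials (t : ℝ) (P : ℕ → ℝ[X]) : Prop where
  monic : ∀ n, (P n).Monic
  natDegree_eq : ∀ n, (P n).natDegree = n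
  orthogonal : ∃ h : ℕ → ℝ, (∀ j, 0 < h j) ∧
    ∀ j k, ∫ x : ℝ, (P j).eval x * (P k).eval x * freudWeight t x = if j = k then h j else 0

/-- `β` is the sequence of recurrence coefficients of the monic orthogonal polynomials of the
quartic Freud weight: `x P₀ = P₁` with `β₀ = 0`, and `x Pₙ = Pₙ₊₁ + βₙ Pₙ₋₁` for `n ≥ 1`
(written with `n + 1` in place of `n`). -/
def IsFreudRecurrenceCoeff (t : ℝ) (β : ℕ → ℝ) : Prop :=
  ∃ P : ℕ → ℝ[X], IsMonicFreudPolynomials t P ∧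
    β 0 = 0 ∧ X * P 0 = P 1 ∧
    ∀ n, X * P (n + 1) = P (n + 2) + C (β (n + 1)) * P n

/-!
The moment functional of the weight is positive definite and even, so it has a unique sequence of
monic orthogonal polynomials, with a three-term recurrence without diagonal term. Integrating
the derivative of `Pₙ Pₙ₊₁ w` turns the recurrence into the discrete Painlevé equation
`4 βₙ (βₙ₋₁ + βₙ + βₙ₊₁) - 2 t βₙ = n`. Its nonnegative solutions satisfy `βₙ ~ √(n / 12)`: the
set of cluster points of `βₙ / √n` is compact, and the equations at its largest and smallest
elements force them to coincide.

Near such a solution the linearised equation bounds an error `eₙ` by roughly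
`(|eₙ₋₁| + |eₙ₊₁|) / 4` plus the residual divided by `√n`. As `1 / 4 < 1 / 2`, a maximum principle
shows that any approximate solution of the same leading order deviates from `βₙ` by
`O(residual / √n)`. The series is the expansion of `(t + √(12 n + t²)) / 12`, which solves
`12 β² - 2 t β = n`, corrected for the second difference `βₙ₋₁ - 2 βₙ + βₙ₊₁`; its truncation has
residual `O(n⁻³)`.
-/

open scoped Topology

/-! ### Monic orthogonal polynomials of a linear functional -/

/-- `p` is the monic orthogonal polynomial of degree `n` of the linear functional `L`. Only
orthogonality to the polynomials of lower degree is required, so the notion makes sense for a single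
polynomial and not just for a sequence. -/
structure IsMonicOrthogonal {R : Type*} [CommRing R] (L : R[X] →ₗ[R] R) (n : ℕ) (p : R[X]) :
    Prop where
  monic : p.Monic
  natDegree_eq : p.natDegree = n
  map_mul_of_degree_lt : ∀ {q : R[X]}, q.degree < n → L (p * q) = 0

/-- `P` is the sequence of monic orthogonal polynomials of the functional `L` and `β` the sequence
of coefficients in its three-term recurrence, which has no middle term (as for a functional that is
invariant under `X ↦ -X`). -/
structure IsMonicOrthogonalRecurrence {R : Type*} [CommRing R] (L : R[X] →ₗ[R] R) (P : ℕ → R[X])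
    (β : ℕ → R) : Prop where
  isMonicOrthogonal : ∀ n, IsMonicOrthogonal L n (P n)
  coeff_zero : β 0 = 0
  X_mul_zero : X * P 0 = P 1
  X_mul_succ : ∀ n, X * P (n + 1) = P (n + 2) + C (β (n + 1)) * P n

section CommRing

variable {R : Type*} [CommRing R] {L : R[X] →ₗ[R] R} {n : ℕ} {p q r : R[X]}

lemma map_C_mul_eq (L : R[X] →ₗ[R] R) (c : R) (p : R[X]) : L (C c * p) = c * L p := by
  rw [← smul_eq_C_mul, map_smul, smul_eq_mul]

lemma degree_sub_C_coeff_mul_lt (hp : p.Monic) (hpn : p.natDegree = n)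
    (hq : q.degree < (n + 1 : ℕ)) : (q - C (q.coeff n) * p).degree < n := by
  rw [degree_lt_iff_coeff_zero] at hq ⊢
  intro k hk
  rw [coeff_sub, coeff_C_mul]
  rcases hk.eq_or_lt with rfl | hk
  · rw [← hpn, hp.coeff_natDegree, mul_one, sub_self]
  · have hpk : p.coeff k = 0 := coeff_eq_zero_of_natDegree_lt (hpn ▸ hk)
    rw [hq k hk, hpk, mul_zero, sub_zero]

lemma map_mul_eq_zero_of_degree_lt_succ (hp : p.Monic) (hpn : p.natDegree = n)
    (hrp : L (r * p) = 0) (hr : ∀ s : R[X], s.degree < n → L (r * s) = 0)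
    (hq : q.degree < (n + 1 : ℕ)) : L (r * q) = 0 := by
  have h := hr _ (degree_sub_C_coeff_mul_lt hp hpn hq)
  rwa [mul_sub, map_sub, mul_left_comm, map_C_mul_eq, hrp, mul_zero, sub_zero] at h

lemma degree_lt_succ_of_natDegree_eq (hp : p.natDegree = n) : p.degree < (n + 1 : ℕ) :=
  degree_le_natDegree.trans_lt (by rw [hp]; exact_mod_cast n.lt_succ_self)

lemma eq_zero_of_degree_lt_zero (hp : p.degree < (0 : ℕ)) : p = 0 :=
  degree_eq_bot.1 (Nat.WithBot.lt_zero_iff.1 hp)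

lemma degree_X_mul_lt (hp : p.degree < n) : (X * p : R[X]).degree < (n + 1 : ℕ) := by
  rw [degree_lt_iff_coeff_zero] at hp ⊢
  rintro (_ | k) hk
  · omega
  · rw [coeff_X_mul, hp k (by omega)]

namespace IsMonicOrthogonal

lemma map_mul_of_degree_lt_succ (hp : IsMonicOrthogonal L n p) (hq : q.degree < (n + 1 : ℕ)) :
    L (p * q) = q.coeff n * L (p * p) := by
  have h := hp.map_mul_of_degree_lt (degree_sub_C_coeff_mul_lt hp.monic hp.natDegree_eq hq)
  rwa [mul_sub, map_sub, mul_left_comm, map_C_mul_eq, sub_eq_zero] at h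

lemma map_mul_of_monic (hp : IsMonicOrthogonal L n p) (hq : q.Monic) (hqn : q.natDegree = n) :
    L (p * q) = L (p * p) := by
  rw [hp.map_mul_of_degree_lt_succ (degree_lt_succ_of_natDegree_eq hqn), ← hqn, hq.coeff_natDegree,
    one_mul]

lemma map_mul_X_mul (hp : IsMonicOrthogonal L n p) (hq : IsMonicOrthogonal L (n + 1) q) :
    L (q * (X * p)) = L (q * q) := by
  nontriviality R
  refine hq.map_mul_of_monic (monic_X.mul hp.monic) ?_
  rw [monic_X.natDegree_mul hp.monic, natDegree_X, hp.natDegree_eq, add_comm]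

lemma map_mul_eq_zero_of_lt {m : ℕ} (hp : IsMonicOrthogonal L m p) (hq : IsMonicOrthogonal L n q)
    (hmn : m < n) : L (q * p) = 0 :=
  hq.map_mul_of_degree_lt <| (degree_lt_succ_of_natDegree_eq hp.natDegree_eq).trans_le <| by
    exact_mod_cast hmn

lemma eq (hL : ∀ p, p ≠ 0 → L (p * p) ≠ 0) (hp : IsMonicOrthogonal L n p)
    (hq : IsMonicOrthogonal L n q) : p = q := by
  have hdeg : (p - q).degree < n := by
    have hcoeff : p.coeff n = 1 := by rw [← hp.natDegree_eq, hp.monic.coeff_natDegree]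
    simpa only [hcoeff, map_one, one_mul] using degree_sub_C_coeff_mul_lt hq.monic hq.natDegree_eq
      (degree_lt_succ_of_natDegree_eq hp.natDegree_eq)
  by_contra hne
  refine hL _ (sub_ne_zero.2 hne) ?_
  rw [sub_mul, map_sub, hp.map_mul_of_degree_lt hdeg, hq.map_mul_of_degree_lt hdeg, sub_zero]

lemma one (L : R[X] →ₗ[R] R) : IsMonicOrthogonal L 0 1 where
  monic := monic_one
  natDegree_eq := natDegree_one
  map_mul_of_degree_lt hq := by
    rw [eq_zero_of_degree_lt_zero hq, mul_zero, map_zero]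

lemma X_sub_C [Nontrivial R] {a : R} (ha : a * L 1 = L X) : IsMonicOrthogonal L 1 (X - C a) where
  monic := monic_X_sub_C a
  natDegree_eq := natDegree_X_sub_C a
  map_mul_of_degree_lt hq := by
    refine map_mul_eq_zero_of_degree_lt_succ (n := 0) monic_one natDegree_one ?_ ?_ hq
    · rw [mul_one, map_sub, ← ha, ← mul_one (C a), map_C_mul_eq, sub_self]
    · intro s hs
      rw [eq_zero_of_degree_lt_zero hs, mul_zero, map_zero]

lemma three_term [Nontrivial R] {a b : R} (hp : IsMonicOrthogonal L n p)
    (hq : IsMonicOrthogonal L (n + 1) q)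
    (ha : a * L (q * q) = L (X * q * q)) (hb : b * L (p * p) = L (q * q)) :
    IsMonicOrthogonal L (n + 2) ((X - C a) * q - C b * p) := by
  have hmonic : ((X - C a) * q).Monic := (monic_X_sub_C a).mul hq.monic
  have hdeg : ((X - C a) * q).natDegree = n + 2 := by
    rw [(monic_X_sub_C a).natDegree_mul hq.monic, natDegree_X_sub_C, hq.natDegree_eq]; ring
  have hlt : (C b * p).natDegree < ((X - C a) * q).natDegree := by
    rw [hdeg]
    exact (natDegree_C_mul_le _ _).trans_lt (by rw [hp.natDegree_eq]; omega)
  have hmap (s : R[X]) : L (((X - C a) * q - C b * p) * s) =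
      L (q * (X * s)) - a * L (q * s) - b * L (p * s) := by
    simp only [← map_C_mul_eq, ← map_sub]
    congr 1
    ring
  refine ⟨hmonic.sub_of_left (degree_lt_degree hlt),
    (natDegree_sub_eq_left_of_natDegree_lt hlt).trans hdeg, fun hs => ?_⟩
  refine map_mul_eq_zero_of_degree_lt_succ hq.monic hq.natDegree_eq ?_ (fun s hs => ?_) hs
  · rw [hmap, mul_comm p q, hp.map_mul_eq_zero_of_lt hq n.lt_succ_self, ha, mul_left_comm,
      mul_assoc]
    ring
  refine map_mul_eq_zero_of_degree_lt_succ hp.monic hp.natDegree_eq ?_ (fun s hs => ?_) hs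
  · rw [hmap, hp.map_mul_X_mul hq, hp.map_mul_eq_zero_of_lt hq n.lt_succ_self, hb]
    ring
  · rw [hmap, hq.map_mul_of_degree_lt (degree_X_mul_lt hs),
      hq.map_mul_of_degree_lt (hs.trans (by exact_mod_cast n.lt_succ_self)),
      hp.map_mul_of_degree_lt hs]
    ring

lemma map_mul_derivative (hp : IsMonicOrthogonal L n p) (hq : IsMonicOrthogonal L (n + 1) q) :
    L (derivative (p * q)) = (n + 1) * L (p * p) := by
  have hlower : L (q * derivative p) = 0 :=
    hq.map_mul_of_degree_lt <| degree_derivative_le.trans_lt <|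
      degree_lt_succ_of_natDegree_eq hp.natDegree_eq
  have hlead : (derivative q).coeff n = n + 1 := by
    rw [coeff_derivative, ← hq.natDegree_eq, hq.monic.coeff_natDegree, one_mul]
  have hdeg : (derivative q).degree < (n + 1 : ℕ) := by
    rw [degree_lt_iff_coeff_zero]
    intro k hk
    rw [coeff_derivative, coeff_eq_zero_of_natDegree_lt (by rw [hq.natDegree_eq]; omega), zero_mul]
  rw [derivative_mul, map_add, mul_comm (derivative p), hlower, zero_add,
    hp.map_mul_of_degree_lt_succ hdeg, hlead]

end IsMonicOrthogonal

namespace IsMonicOrthogonalRecurrence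

variable {P : ℕ → R[X]} {β : ℕ → R}

lemma map_sq_succ (h : IsMonicOrthogonalRecurrence L P β) (n : ℕ) :
    L (P (n + 1) * P (n + 1)) = β (n + 1) * L (P n * P n) := by
  have horth : L (P (n + 2) * P n) = 0 :=
    (h.isMonicOrthogonal n).map_mul_eq_zero_of_lt (h.isMonicOrthogonal (n + 2)) (by omega)
  have hexp : P (n + 1) * (X * P n) = P (n + 2) * P n + C (β (n + 1)) * (P n * P n) := by
    linear_combination P n * h.X_mul_succ n
  rw [← (h.isMonicOrthogonal n).map_mul_X_mul (h.isMonicOrthogonal (n + 1)), hexp, map_add, horth,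
    map_C_mul_eq, zero_add]

lemma map_X_mul_sq (h : IsMonicOrthogonalRecurrence L P β) (n : ℕ) :
    L ((X * P n) * (X * P n)) = (β n + β (n + 1)) * L (P n * P n) := by
  cases n with
  | zero => rw [h.X_mul_zero, h.coeff_zero, zero_add, zero_add, ← h.map_sq_succ]
  | succ n =>
    have horth : L (P (n + 2) * P n) = 0 :=
      (h.isMonicOrthogonal n).map_mul_eq_zero_of_lt (h.isMonicOrthogonal (n + 2)) (by omega)
    have hexp : (X * P (n + 1)) * (X * P (n + 1)) = P (n + 2) * P (n + 2) +
        C (2 * β (n + 1)) * (P (n + 2) * P n) + C (β (n + 1) * β (n + 1)) * (P n * P n) := by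
      rw [h.X_mul_succ n]
      simp only [C_mul, map_ofNat]
      ring
    rw [hexp, map_add, map_add, map_C_mul_eq, map_C_mul_eq, horth, h.map_sq_succ (n + 1),
      h.map_sq_succ n]
    ring

lemma map_mul_succ_mul_X_pow_three (h : IsMonicOrthogonalRecurrence L P β) (n : ℕ) :
    L (P n * P (n + 1) * X ^ 3) =
      β (n + 1) * (β n + β (n + 1) + β (n + 2)) * L (P n * P n) := by
  have htop : L (P (n + 2) * (X * (X * P n))) = L (P (n + 2) * P (n + 2)) := by
    nontriviality R
    have hmonic := (h.isMonicOrthogonal n).monic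
    refine (h.isMonicOrthogonal (n + 2)).map_mul_of_monic (monic_X.mul (monic_X.mul hmonic)) ?_
    rw [monic_X.natDegree_mul (monic_X.mul hmonic), monic_X.natDegree_mul hmonic, natDegree_X,
      (h.isMonicOrthogonal n).natDegree_eq]
    ring
  have hexp : P n * P (n + 1) * X ^ 3 =
      P (n + 2) * (X * (X * P n)) + C (β (n + 1)) * ((X * P n) * (X * P n)) := by
    linear_combination (P n * X ^ 2) * h.X_mul_succ n
  rw [hexp, map_add, htop, map_C_mul_eq, h.map_X_mul_sq, h.map_sq_succ (n + 1), h.map_sq_succ n]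
  ring

-- Evaluate `L (derivative (P n * P (n + 1)))` by orthogonality and by the Pearson equation `hL`.
lemma string_equation [IsCancelMulZero R] {a b : R} (h : IsMonicOrthogonalRecurrence L P β)
    (hL : ∀ p, L (derivative p) = L (p * (C a * X ^ 3 - C b * X))) {n : ℕ}
    (hn : L (P n * P n) ≠ 0) :
    β (n + 1) * (a * (β n + β (n + 1) + β (n + 2)) - b) = n + 1 := by
  have hX : L (P n * P (n + 1) * X) = β (n + 1) * L (P n * P n) := by
    rw [← h.map_sq_succ, ← (h.isMonicOrthogonal n).map_mul_X_mul (h.isMonicOrthogonal (n + 1))]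
    congr 1
    ring
  have hexp : P n * P (n + 1) * (C a * X ^ 3 - C b * X) =
      C a * (P n * P (n + 1) * X ^ 3) - C b * (P n * P (n + 1) * X) := by ring
  have hparts := hL (P n * P (n + 1))
  rw [(h.isMonicOrthogonal n).map_mul_derivative (h.isMonicOrthogonal (n + 1)), hexp, map_sub,
    map_C_mul_eq, map_C_mul_eq, h.map_mul_succ_mul_X_pow_three, hX] at hparts
  exact mul_right_cancel₀ hn (by linear_combination -hparts)

lemma coeff_eq {Q : ℕ → R[X]} {γ : ℕ → R} (hL : ∀ p, p ≠ 0 → L (p * p) ≠ 0)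
    (h : IsMonicOrthogonalRecurrence L P β) (h' : IsMonicOrthogonalRecurrence L Q γ) : β = γ := by
  obtain rfl : P = Q :=
    funext fun n => (h.isMonicOrthogonal n).eq hL (h'.isMonicOrthogonal n)
  funext n
  cases n with
  | zero => rw [h.coeff_zero, h'.coeff_zero]
  | succ n =>
    refine C_injective ((h.isMonicOrthogonal n).monic.isRegular.right ?_)
    exact add_left_cancel ((h.X_mul_succ n).symm.trans (h'.X_mul_succ n))

end IsMonicOrthogonalRecurrence

end CommRing

section Field

variable {K : Type*} [Field K] {L : K[X] →ₗ[K] K} {n : ℕ} {p : K[X]}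

-- Definiteness makes the Gram form on polynomials of degree `< n` injective, hence surjective onto
-- the dual space; so some `r` of degree `< n` has the same products with them as `X ^ n`.
lemma exists_isMonicOrthogonal (hL : ∀ p, p ≠ 0 → L (p * p) ≠ 0) (n : ℕ) :
    ∃ p, IsMonicOrthogonal L n p := by
  let B : K[X] →ₗ[K] degreeLT K n →ₗ[K] K :=
    ((LinearMap.mul K K[X]).compr₂ L).compl₂ (degreeLT K n).subtype
  let G : degreeLT K n →ₗ[K] Module.Dual K (degreeLT K n) := B ∘ₗ (degreeLT K n).subtype
  have : FiniteDimensional K (degreeLT K n) := (degreeLTEquiv K n).symm.finiteDimensional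
  have hinj : Function.Injective G := (injective_iff_map_eq_zero G).2 fun r hr => by
    by_contra hne
    exact hL r (by simpa using hne) (LinearMap.congr_fun hr r)
  obtain ⟨r, hr⟩ := (LinearMap.injective_iff_surjective_of_finrank_eq_finrank
    Subspace.dual_finrank_eq.symm).1 hinj (B (X ^ n))
  have hdeg : (r : K[X]).degree < n := mem_degreeLT.1 r.2
  refine ⟨X ^ n - (r : K[X]), monic_X_pow_sub hdeg, ?_, fun {q} hq => ?_⟩
  · refine natDegree_eq_of_degree_eq_some ?_
    rw [degree_sub_eq_left_of_degree_lt (by rwa [degree_X_pow]), degree_X_pow]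
  · have h : L (r * q) = L (X ^ n * q) := LinearMap.congr_fun hr ⟨q, mem_degreeLT.2 hq⟩
    rw [sub_mul, map_sub, h, sub_self]

lemma map_eq_zero_of_comp_neg_X_eq_neg [NeZero (2 : K)] (hsymm : ∀ p, L (p.comp (-X)) = L p)
    (hp : p.comp (-X) = -p) : L p = 0 := by
  have h := hsymm p
  rw [hp, map_neg] at h
  exact (mul_eq_zero.1 (by linear_combination -h : 2 * L p = 0)).resolve_left two_ne_zero

namespace IsMonicOrthogonal

lemma comp_neg_X (hsymm : ∀ p, L (p.comp (-X)) = L p) (hp : IsMonicOrthogonal L n p) :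
    IsMonicOrthogonal L n ((-1) ^ n * p.comp (-X)) where
  monic := by
    have := hp.monic.neg_one_pow_natDegree_mul_comp_neg_X
    rwa [hp.natDegree_eq] at this
  natDegree_eq := by
    rw [← C_1, ← C_neg, ← C_pow, natDegree_C_mul (by simp), natDegree_comp, natDegree_neg,
      natDegree_X, mul_one, hp.natDegree_eq]
  map_mul_of_degree_lt {q} hq := by
    have hcomp : p.comp (-X) * q = (p * q.comp (-X)).comp (-X) := by
      rw [mul_comp, comp_assoc, neg_comp, X_comp, neg_neg, comp_X]
    rw [← C_1, ← C_neg, ← C_pow, mul_assoc, map_C_mul_eq, hcomp, hsymm,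
      hp.map_mul_of_degree_lt, mul_zero]
    rwa [degree_comp_neg_X]

lemma map_X_mul_sq_eq_zero [NeZero (2 : K)] (hL : ∀ p, p ≠ 0 → L (p * p) ≠ 0)
    (hsymm : ∀ p, L (p.comp (-X)) = L p) (hp : IsMonicOrthogonal L n p) : L (X * p * p) = 0 := by
  have hpar : p = (-1) ^ n * p.comp (-X) := hp.eq hL (hp.comp_neg_X hsymm)
  have hsign : ((-1 : K[X]) ^ n) * (-1) ^ n = 1 := by
    rw [← mul_pow, neg_one_mul, neg_neg, one_pow]
  refine map_eq_zero_of_comp_neg_X_eq_neg hsymm ?_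
  rw [mul_comp, mul_comp, X_comp]
  nth_rw 3 4 [hpar]
  linear_combination (X * p.comp (-X) * p.comp (-X)) * hsign

end IsMonicOrthogonal

theorem existsUnique_recurrenceCoeff [NeZero (2 : K)] (hL : ∀ p, p ≠ 0 → L (p * p) ≠ 0)
    (hsymm : ∀ p, L (p.comp (-X)) = L p) : ∃! β, ∃ P, IsMonicOrthogonalRecurrence L P β := by
  choose P hP using exists_isMonicOrthogonal hL
  let β : ℕ → K
    | 0 => 0
    | n + 1 => L (P (n + 1) * P (n + 1)) / L (P n * P n)
  have hβ (n : ℕ) : β (n + 1) * L (P n * P n) = L (P (n + 1) * P (n + 1)) :=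
    div_mul_cancel₀ _ (hL _ (hP n).monic.ne_zero)
  have hzero (n : ℕ) : 0 * L (P n * P n) = L (X * P n * P n) := by
    rw [zero_mul, (hP n).map_X_mul_sq_eq_zero hL hsymm]
  have hrec : IsMonicOrthogonalRecurrence L P β :=
    { isMonicOrthogonal := hP
      coeff_zero := rfl
      X_mul_zero := by
        have hP0 : P 0 = 1 := (hP 0).eq hL (.one L)
        have hX : IsMonicOrthogonal L 1 (X - C 0) := .X_sub_C (by simpa [hP0] using hzero 0)
        rw [(hP 1).eq hL hX, hP0, mul_one, C_0, sub_zero]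
      X_mul_succ := fun n => by
        rw [(hP (n + 2)).eq hL ((hP n).three_term (hP (n + 1)) (hzero (n + 1)) (hβ n)), C_0]
        ring }
  exact ⟨β, ⟨P, hrec⟩, fun γ ⟨Q, hγ⟩ => hγ.coeff_eq hL hrec⟩

end Field

/-! ### The moment functional of the quartic Freud weight -/

lemma freudWeight_pos (t x : ℝ) : 0 < freudWeight t x := Real.exp_pos _

lemma continuous_freudWeight (t : ℝ) : Continuous (freudWeight t) := by
  unfold freudWeight; fun_prop

lemma freudWeight_le (t x : ℝ) :
    freudWeight t x ≤ Real.exp ((t + 1) ^ 2 / 4) * Real.exp (-1 * x ^ 2) := by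
  rw [← Real.exp_add]
  exact Real.exp_le_exp.2 (by nlinarith [sq_nonneg (x ^ 2 - (t + 1) / 2)])

lemma integrable_pow_mul_freudWeight (t : ℝ) (k : ℕ) :
    Integrable fun x : ℝ => x ^ k * freudWeight t x := by
  have hg : Integrable fun x : ℝ =>
      Real.exp ((t + 1) ^ 2 / 4) * (x ^ k * Real.exp (-1 * x ^ 2)) := by
    have := integrable_rpow_mul_exp_neg_mul_sq (b := 1) one_pos (s := k)
      (by have : (0 : ℝ) ≤ k := k.cast_nonneg
          linarith)
    simp only [Real.rpow_natCast] at this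
    exact this.const_mul _
  refine hg.mono (by have := continuous_freudWeight t; fun_prop) (.of_forall fun x => ?_)
  simp only [norm_mul, Real.norm_eq_abs, Real.abs_exp, abs_of_pos (freudWeight_pos t x)]
  calc |x ^ k| * freudWeight t x
      ≤ |x ^ k| * (Real.exp ((t + 1) ^ 2 / 4) * Real.exp (-1 * x ^ 2)) := by
        gcongr; exact freudWeight_le t x
    _ = _ := by ring

lemma integrable_eval_mul_freudWeight (t : ℝ) (p : ℝ[X]) :
    Integrable fun x : ℝ => p.eval x * freudWeight t x := by
  induction p using Polynomial.induction_on' with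
  | add p q hp hq =>
    simp only [eval_add, add_mul]
    exact hp.add hq
  | monomial n a =>
    simpa only [eval_monomial, mul_assoc] using (integrable_pow_mul_freudWeight t n).const_mul a

/-- The moment functional `p ↦ ∫ p w` of the quartic Freud weight. -/
noncomputable def freudFunctional (t : ℝ) : ℝ[X] →ₗ[ℝ] ℝ where
  toFun p := ∫ x : ℝ, p.eval x * freudWeight t x
  map_add' p q := by
    simp only [eval_add, add_mul]
    exact integral_add (integrable_eval_mul_freudWeight t p) (integrable_eval_mul_freudWeight t q)
  map_smul' c p := by
    simp only [eval_smul, smul_eq_mul, mul_assoc, RingHom.id_apply]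
    exact integral_const_mul _ _

lemma freudFunctional_apply (t : ℝ) (p : ℝ[X]) :
    freudFunctional t p = ∫ x : ℝ, p.eval x * freudWeight t x := rfl

lemma freudFunctional_mul_self_pos (t : ℝ) {p : ℝ[X]} (hp : p ≠ 0) :
    0 < freudFunctional t (p * p) := by
  rw [freudFunctional_apply, integral_pos_iff_support_of_nonneg _
    (integrable_eval_mul_freudWeight t _)]
  · have hs : Function.support (fun x : ℝ => (p * p).eval x * freudWeight t x)
        = {x | p.eval x ≠ 0} := by
      ext x
      simp [(freudWeight_pos t x).ne']
    rw [hs]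
    refine IsOpen.measure_pos _ (isOpen_ne_fun p.continuous continuous_const) ?_
    by_contra h
    refine hp (Polynomial.funext fun x => ?_)
    by_contra hx
    exact h ⟨x, by simpa using hx⟩
  · intro x
    simpa using mul_nonneg (mul_self_nonneg _) (freudWeight_pos t x).le

lemma freudFunctional_comp_neg_X (t : ℝ) (p : ℝ[X]) :
    freudFunctional t (p.comp (-X)) = freudFunctional t p := by
  simp only [freudFunctional_apply]
  rw [← integral_neg_eq_self (fun x : ℝ => p.eval x * freudWeight t x)]
  simp [freudWeight, eval_comp, Even.neg_pow (by decide : Even 4)]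

-- Integration by parts: `w' = -(4 x ^ 3 - 2 t x) w`.
lemma freudFunctional_derivative (t : ℝ) (p : ℝ[X]) :
    freudFunctional t (derivative p) = freudFunctional t (p * (C 4 * X ^ 3 - C (2 * t) * X)) := by
  rw [← sub_eq_zero, ← map_sub, freudFunctional_apply]
  refine integral_eq_zero_of_hasDerivAt_of_integrable (f := fun x => p.eval x * freudWeight t x)
    (fun x => ?_) (integrable_eval_mul_freudWeight t _) (integrable_eval_mul_freudWeight t _)
  have h : HasDerivAt (fun x : ℝ => -x ^ 4 + t * x ^ 2) (-(4 * x ^ 3) + t * (2 * x)) x := by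
    refine ((hasDerivAt_pow 4 x).neg.add ((hasDerivAt_pow 2 x).const_mul t)).congr_deriv ?_
    norm_num
  refine ((p.hasDerivAt x).mul h.exp).congr_deriv ?_
  simp only [freudWeight, eval_sub, eval_mul, eval_C, eval_pow, eval_X]
  ring

lemma isMonicFreudPolynomials_iff {t : ℝ} {P : ℕ → ℝ[X]} :
    IsMonicFreudPolynomials t P ↔ ∀ n, IsMonicOrthogonal (freudFunctional t) n (P n) := by
  refine ⟨fun hP n => ⟨hP.monic n, hP.natDegree_eq n, fun {q} hq => ?_⟩, fun hP => ?_⟩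
  · obtain ⟨h, -, horth⟩ := hP.orthogonal
    suffices H : ∀ m ≤ n, ∀ q : ℝ[X], q.degree < m → freudFunctional t (P n * q) = 0 from
      H n le_rfl q hq
    intro m
    induction m with
    | zero =>
      intro _ q hq
      rw [eq_zero_of_degree_lt_zero hq, mul_zero, map_zero]
    | succ m ih =>
      intro hm q hq
      have hnm : freudFunctional t (P n * P m) = 0 := by
        simpa only [freudFunctional_apply, eval_mul, if_neg (by omega : n ≠ m)] using horth n m
      exact map_mul_eq_zero_of_degree_lt_succ (hP.monic m) (hP.natDegree_eq m) hnm
        (ih (by omega)) hq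
  · refine ⟨fun n => (hP n).monic, fun n => (hP n).natDegree_eq,
      fun j => freudFunctional t (P j * P j),
      fun j => freudFunctional_mul_self_pos t (hP j).monic.ne_zero, fun j k => ?_⟩
    simp only [← eval_mul, ← freudFunctional_apply]
    split_ifs with h
    · rw [h]
    · rcases lt_or_gt_of_ne h with hjk | hkj
      · rw [mul_comm, (hP j).map_mul_eq_zero_of_lt (hP k) hjk]
      · rw [(hP k).map_mul_eq_zero_of_lt (hP j) hkj]

lemma isFreudRecurrenceCoeff_iff {t : ℝ} {β : ℕ → ℝ} :
    IsFreudRecurrenceCoeff t β ↔ ∃ P, IsMonicOrthogonalRecurrence (freudFunctional t) P β :=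
  exists_congr fun _ => ⟨fun ⟨hP, hzero, hX, hrec⟩ =>
      ⟨isMonicFreudPolynomials_iff.1 hP, hzero, hX, hrec⟩,
    fun h => ⟨isMonicFreudPolynomials_iff.2 h.isMonicOrthogonal, h.coeff_zero, h.X_mul_zero,
      h.X_mul_succ⟩⟩

theorem existsUnique_isFreudRecurrenceCoeff (t : ℝ) :
    ∃! β : ℕ → ℝ, IsFreudRecurrenceCoeff t β := by
  simp only [isFreudRecurrenceCoeff_iff]
  exact existsUnique_recurrenceCoeff (fun _ hp => (freudFunctional_mul_self_pos t hp).ne')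
    (freudFunctional_comp_neg_X t)

/-- The residual of the sequence `b` in the string equation (a discrete Painlevé I equation)
`4 bₙ (bₙ₋₁ + bₙ + bₙ₊₁) - 2 t bₙ = n`, with `n + 1` in place of `n`. -/
def stringResidual (t : ℝ) (b : ℕ → ℝ) (n : ℕ) : ℝ :=
  4 * b (n + 1) * (b n + b (n + 1) + b (n + 2)) - 2 * t * b (n + 1) - (n + 1)

namespace IsFreudRecurrenceCoeff

variable {t : ℝ} {β : ℕ → ℝ}

lemma nonneg (hβ : IsFreudRecurrenceCoeff t β) (n : ℕ) : 0 ≤ β n := by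
  obtain ⟨P, hP⟩ := isFreudRecurrenceCoeff_iff.1 hβ
  cases n with
  | zero => exact hP.coeff_zero.ge
  | succ n =>
    have hpos (k : ℕ) : 0 < freudFunctional t (P k * P k) :=
      freudFunctional_mul_self_pos t (hP.isMonicOrthogonal k).monic.ne_zero
    exact (pos_of_mul_pos_left (hP.map_sq_succ n ▸ hpos (n + 1)) (hpos n).le).le

lemma stringResidual_eq_zero (hβ : IsFreudRecurrenceCoeff t β) (n : ℕ) :
    stringResidual t β n = 0 := by
  obtain ⟨P, hP⟩ := isFreudRecurrenceCoeff_iff.1 hβ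
  have h := hP.string_equation (freudFunctional_derivative t)
    (freudFunctional_mul_self_pos t (hP.isMonicOrthogonal n).monic.ne_zero).ne'
  rw [stringResidual]
  linear_combination h

end IsFreudRecurrenceCoeff

/-! ### Leading asymptotics -/

-- Compare the equations for the largest and the smallest element of `S`.
lemma eq_sqrt_of_mem_of_forall_exists_mul_add_eq {S : Set ℝ} {κ c : ℝ} (hS : IsCompact S)
    (hnonneg : ∀ c ∈ S, 0 ≤ c) (h : ∀ c ∈ S, ∃ l ∈ S, ∃ r ∈ S, c * (l + c + r) = κ) (hc : c ∈ S) :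
    c = √(κ / 3) := by
  obtain ⟨A, hA, hmax⟩ := hS.exists_isGreatest ⟨c, hc⟩
  obtain ⟨a, ha, hmin⟩ := hS.exists_isLeast ⟨c, hc⟩
  obtain ⟨l, hl, r, hr, hAκ⟩ := h A hA
  obtain ⟨l', hl', r', hr', haκ⟩ := h a ha
  have hupper : A * (2 * a + A) ≤ κ := by
    rw [← hAκ]
    exact mul_le_mul_of_nonneg_left (by linarith [hmin hl, hmin hr]) (hnonneg A hA)
  have hlower : κ ≤ a * (2 * A + a) := by
    rw [← haκ]
    exact mul_le_mul_of_nonneg_left (by linarith [hmax hl', hmax hr']) (hnonneg a ha)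
  have hle : A ≤ a :=
    (pow_le_pow_iff_left₀ (hnonneg A hA) (hnonneg a ha) two_ne_zero).1 (by linarith)
  have heq {d : ℝ} (hd : d ∈ S) : d = A := le_antisymm (hmax hd) (hle.trans (hmin hd))
  rw [heq hc, ← hAκ, heq hl, heq hr, show A * (A + A + A) / 3 = A ^ 2 by ring,
    Real.sqrt_sq (hnonneg A hA)]

section ClusterPoints

variable {x : ℕ → ℝ} {B : ℝ}

lemma exists_mapClusterPt_neighbors {u v : ℕ → ℝ} {κ c : ℝ} (hx : ∀ n, x n ∈ Set.Icc 0 B)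
    (hu : Tendsto u atTop (𝓝 1)) (hv : Tendsto v atTop (𝓝 1))
    (h : Tendsto (fun n => x (n + 1) * (u n * x n + x (n + 1) + v n * x (n + 2))) atTop (𝓝 κ))
    (hc : MapClusterPt c atTop x) :
    ∃ l, MapClusterPt l atTop x ∧ ∃ r, MapClusterPt r atTop x ∧ c * (l + c + r) = κ := by
  have hshift : MapClusterPt c atTop (x ∘ (· + 1)) := by
    rwa [MapClusterPt, ← map_map, map_add_atTop_eq_nat]
  obtain ⟨U, hU, hUc⟩ := mapClusterPt_iff_ultrafilter.1 hshift
  have hlim (k : ℕ) : ∃ l, Tendsto (x ∘ (· + k)) U (𝓝 l) := by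
    obtain ⟨l, -, hl⟩ := isCompact_Icc.ultrafilter_le_nhds' (U.map (x ∘ (· + k)))
      (Filter.univ_mem' (f := U) fun n => hx (n + k))
    exact ⟨l, hl⟩
  have hcluster {k : ℕ} {l : ℝ} (hl : Tendsto (x ∘ (· + k)) U (𝓝 l)) : MapClusterPt l atTop x :=
    (mapClusterPt_iff_ultrafilter.2 ⟨U, hU, hl⟩).of_comp (tendsto_add_atTop_nat k)
  obtain ⟨l, hl⟩ := hlim 0
  obtain ⟨r, hr⟩ := hlim 2
  refine ⟨l, hcluster hl, r, hcluster hr, tendsto_nhds_unique ?_ (h.mono_left hU)⟩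
  simpa using hUc.mul ((((hu.mono_left hU).mul hl).add hUc).add ((hv.mono_left hU).mul hr))

lemma tendsto_sqrt_of_tendsto_mul_add {u v : ℕ → ℝ} {κ : ℝ} (hx : ∀ n, x n ∈ Set.Icc 0 B)
    (hu : Tendsto u atTop (𝓝 1)) (hv : Tendsto v atTop (𝓝 1))
    (h : Tendsto (fun n => x (n + 1) * (u n * x n + x (n + 1) + v n * x (n + 2))) atTop (𝓝 κ)) :
    Tendsto x atTop (𝓝 √(κ / 3)) := by
  have hmem {c : ℝ} (hc : MapClusterPt c atTop x) : c ∈ Set.Icc 0 B :=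
    isClosed_Icc.mem_of_mapClusterPt hc (.of_forall hx)
  have hcompact : IsCompact {c | MapClusterPt c atTop x} :=
    isCompact_Icc.of_isClosed_subset isClosed_setOfPred_clusterPt fun c hc => hmem hc
  refine isCompact_Icc.tendsto_nhds_of_unique_mapClusterPt (.of_forall hx) fun c _ hc => ?_
  exact eq_sqrt_of_mem_of_forall_exists_mul_add_eq hcompact (fun c hc => (hmem hc).1)
    (fun c hc => exists_mapClusterPt_neighbors hx hu hv h hc) hc

end ClusterPoints

lemma tendsto_natCast_add_div_natCast_add (a b : ℝ) :
    Tendsto (fun n : ℕ => ((n : ℝ) + a) / (n + b)) atTop (𝓝 1) := by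
  simpa only [one_mul, div_one, add_comm] using
    tendsto_add_mul_div_add_mul_atTop_nhds a b (1 : ℝ) one_ne_zero

lemma tendsto_sqrt_natCast_add_div_sqrt_natCast_add {a : ℝ} (ha : 0 ≤ a) (b : ℝ) :
    Tendsto (fun n : ℕ => √((n : ℝ) + a) / √(n + b)) atTop (𝓝 1) := by
  have h := (tendsto_natCast_add_div_natCast_add a b).sqrt
  rw [Real.sqrt_one] at h
  exact h.congr fun n => Real.sqrt_div (by positivity) _

lemma tendsto_div_sqrt_natCast_add_one (c : ℝ) :
    Tendsto (fun n : ℕ => c / √((n : ℝ) + 1)) atTop (𝓝 0) :=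
  (Real.tendsto_sqrt_atTop.comp
    (tendsto_atTop_add_const_right _ _ tendsto_natCast_atTop_atTop)).const_div_atTop c

section StringEquation

variable {t : ℝ} {b : ℕ → ℝ}

lemma le_mul_sqrt_of_stringResidual_eq_zero (hb : ∀ n, 0 ≤ b n)
    (hs : ∀ n, stringResidual t b n = 0) (n : ℕ) : b (n + 1) ≤ (|t| + 1) * √((n : ℝ) + 1) := by
  have hone : 1 ≤ √((n : ℝ) + 1) := Real.one_le_sqrt.2 (by simp)
  have hsq : √((n : ℝ) + 1) ^ 2 = n + 1 := Real.sq_sqrt (by positivity)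
  have hquad : b (n + 1) * (4 * b (n + 1) - 2 * t) ≤ √((n : ℝ) + 1) ^ 2 := by
    have hres := hs n
    rw [stringResidual] at hres
    nlinarith only [hres, hsq, mul_nonneg (hb (n + 1)) (add_nonneg (hb n) (hb (n + 2)))]
  set s := √((n : ℝ) + 1)
  by_contra! hlt
  have ht : t ≤ |t| * s := (le_abs_self t).trans (le_mul_of_one_le_right (abs_nonneg t) hone)
  have hs0 : s < b (n + 1) := by nlinarith only [hlt, hone, abs_nonneg t]
  nlinarith only [hquad, hlt, ht, hs0, hone]

lemma div_sqrt_mem_Icc_of_stringResidual_eq_zero (hb : ∀ n, 0 ≤ b n)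
    (hs : ∀ n, stringResidual t b n = 0) (n : ℕ) : b n / √n ∈ Set.Icc 0 (|t| + 1) := by
  refine ⟨div_nonneg (hb n) (Real.sqrt_nonneg _), ?_⟩
  cases n with
  | zero => simpa using add_nonneg (abs_nonneg t) zero_le_one
  | succ n =>
    rw [div_le_iff₀ (by positivity), Nat.cast_add_one]
    exact le_mul_sqrt_of_stringResidual_eq_zero hb hs n

lemma tendsto_div_sqrt_of_stringResidual_eq_zero (hb : ∀ n, 0 ≤ b n)
    (hs : ∀ n, stringResidual t b n = 0) :
    Tendsto (fun n : ℕ => b n / √n) atTop (𝓝 (1 / (2 * √3))) := by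
  have hvalue : 1 / (2 * √3) = √(1 / 4 / 3) := by
    rw [div_div, one_div, one_div, Real.sqrt_inv, Real.sqrt_mul zero_le_four,
      show (4 : ℝ) = 2 ^ 2 by norm_num, Real.sqrt_sq zero_le_two]
  have hmem := div_sqrt_mem_Icc_of_stringResidual_eq_zero hb hs
  have hprev : Tendsto (fun n : ℕ => √(n : ℝ) / √(n + 1)) atTop (𝓝 1) := by
    simpa using tendsto_sqrt_natCast_add_div_sqrt_natCast_add le_rfl 1
  have hnext := tendsto_sqrt_natCast_add_div_sqrt_natCast_add zero_le_two 1
  rw [hvalue]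
  refine tendsto_sqrt_of_tendsto_mul_add hmem hprev hnext ?_
  have hsmall : Tendsto (fun n : ℕ => b (n + 1) / √((n + 1 : ℕ) : ℝ) * (t / 2 / √((n : ℝ) + 1)))
      atTop (𝓝 0) :=
    bdd_le_mul_tendsto_zero' (|t| + 1)
      (.of_forall fun n => by rw [abs_of_nonneg (hmem _).1]; exact (hmem _).2)
      (tendsto_div_sqrt_natCast_add_one _)
  have hlim := hsmall.const_add (1 / 4)
  rw [add_zero] at hlim
  refine hlim.congr' ?_
  filter_upwards [eventually_gt_atTop 0] with n hn
  have hres := hs n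
  have hsq : √((n : ℝ) + 1) ^ 2 = n + 1 := Real.sq_sqrt (by positivity)
  rw [stringResidual, ← hsq] at hres
  push_cast
  field_simp
  linear_combination -2 * hres

end StringEquation

/-! ### Discrete comparison principle -/

-- At a positive maximum `v (k + 1) ≤ 2 θ v (k + 1) < v (k + 1)`.
lemma nonpos_of_le_mul_neighbors {v : ℕ → ℝ} {θ : ℝ} {N n : ℕ} (hθ0 : 0 ≤ θ) (hθ : θ < 1 / 2)
    (hv : ∀ n ≥ N, v (n + 1) ≤ θ * (v n + v (n + 2))) (hN : v N ≤ 0)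
    (hlarge : ∀ᶠ n in atTop, v n ≤ 0) (hn : N ≤ n) : v n ≤ 0 := by
  obtain ⟨T, hT⟩ := eventually_atTop.1 hlarge
  obtain ⟨m, hm, hmax⟩ := Finset.exists_max_image (Finset.Icc N (max n T)) v
    ⟨n, Finset.mem_Icc.2 ⟨hn, le_max_left _ _⟩⟩
  refine (hmax n (Finset.mem_Icc.2 ⟨hn, le_max_left _ _⟩)).trans ?_
  rw [Finset.mem_Icc] at hm
  by_contra! hpos
  have hmN : m ≠ N := fun h => hN.not_gt (h ▸ hpos)
  have hmT : m < T := not_le.1 fun h => (hT m h).not_gt hpos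
  obtain ⟨k, rfl⟩ : ∃ k, m = k + 1 := ⟨m - 1, by omega⟩
  have hleft := hmax k (Finset.mem_Icc.2 (by omega))
  have hright := hmax (k + 2) (Finset.mem_Icc.2 (by omega))
  have hk := hv k (by omega)
  nlinarith

-- Compare with the supersolutions `M + ε r ^ n`, where `r = (2 θ)⁻¹`, and let `ε → 0`.
lemma le_max_of_le_mul_neighbors_add {u : ℕ → ℝ} {θ K : ℝ} {N n : ℕ} (hθ0 : 0 < θ)
    (hθ : θ < 1 / 2) (hu : ∀ n ≥ N, u (n + 1) ≤ θ * (u n + u (n + 2)) + K)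
    (hgrow : u =o[atTop] fun n => (2 * θ)⁻¹ ^ n) (hn : N ≤ n) :
    u n ≤ max (max (u N) 0) (K / (1 - 2 * θ)) := by
  set M := max (max (u N) 0) (K / (1 - 2 * θ))
  have hMN : u N ≤ M := (le_max_left _ _).trans (le_max_left _ _)
  have hM0 : 0 ≤ M := (le_max_right _ _).trans (le_max_left _ _)
  have hMK : K ≤ M * (1 - 2 * θ) := (div_le_iff₀ (by linarith)).1 (le_max_right _ _)
  set r := (2 * θ)⁻¹ with hr
  have hr0 : 0 < r := by positivity
  have hθr : θ * (1 + r ^ 2) ≤ r := by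
    rw [hr]
    field_simp
    nlinarith
  have hsuper (ε : ℝ) (hε : 0 < ε) : u n ≤ M + ε * r ^ n := by
    rw [← sub_nonpos]
    refine nonpos_of_le_mul_neighbors (v := fun n => u n - (M + ε * r ^ n)) hθ0.le hθ
      (fun k hk => ?_) ?_ ?_ hn
    · have hεr : 0 ≤ ε * r ^ k * (r - θ * (1 + r ^ 2)) :=
        mul_nonneg (by positivity) (sub_nonneg.2 hθr)
      simp only [pow_succ]
      linarith [hu k hk]
    · have : 0 < ε * r ^ N := by positivity
      linarith
    · filter_upwards [hgrow.bound hε] with k hk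
      rw [Real.norm_of_nonneg (pow_nonneg hr0.le k)] at hk
      linarith [(le_abs_self (u k)).trans hk]
  refine le_of_forall_pos_le_add fun δ hδ => ?_
  have h := hsuper (δ / r ^ n) (by positivity)
  rwa [div_mul_cancel₀ _ (by positivity)] at h

lemma isBigO_of_abs_le_mul_neighbors {e g w : ℕ → ℝ} {θ : ℝ} (hθ0 : 0 ≤ θ) (hθ : θ < 1 / 2)
    (hw : ∀ᶠ n in atTop, 0 < w n) (hratio : Tendsto (fun n => w (n + 1) / w n) atTop (𝓝 1))
    (hgrow : ∀ r > 1, e =o[atTop] fun n => w n * r ^ n)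
    (he : ∀ᶠ n in atTop, |e (n + 1)| ≤ θ * (|e n| + |e (n + 2)|) + g n)
    (hg : g =O[atTop] fun n => w (n + 1)) : e =O[atTop] w := by
  obtain ⟨θ', hθθ', hθ'⟩ := exists_between hθ
  have hθ'0 : 0 < θ' := hθ0.trans_lt hθθ'
  obtain ⟨K, hK⟩ := hg.bound
  have hprev : ∀ᶠ n in atTop, θ * (w (n + 1) / w n)⁻¹ < θ' :=
    ((hratio.inv₀ one_ne_zero).const_mul θ).eventually_lt_const (by simpa using hθθ')
  have hnext : ∀ᶠ n in atTop, θ * (w (n + 2) / w (n + 1)) < θ' :=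
    ((hratio.comp (tendsto_add_atTop_nat 1)).const_mul θ).eventually_lt_const (by simpa using hθθ')
  have hrec : ∀ᶠ n in atTop, |e (n + 1)| / w (n + 1) ≤
      θ' * (|e n| / w n + |e (n + 2)| / w (n + 2)) + K := by
    filter_upwards [he, hK, hprev, hnext, hw, (tendsto_add_atTop_nat 1).eventually hw,
      (tendsto_add_atTop_nat 2).eventually hw] with n he hK hprev hnext hw0 hw1 hw2
    rw [Real.norm_eq_abs, Real.norm_of_nonneg hw1.le] at hK
    calc |e (n + 1)| / w (n + 1)
        ≤ (θ * (|e n| + |e (n + 2)|) + K * w (n + 1)) / w (n + 1) := by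
          gcongr
          linarith [le_abs_self (g n)]
      _ = θ * (w (n + 1) / w n)⁻¹ * (|e n| / w n)
          + θ * (w (n + 2) / w (n + 1)) * (|e (n + 2)| / w (n + 2)) + K := by
        field_simp
      _ ≤ θ' * (|e n| / w n) + θ' * (|e (n + 2)| / w (n + 2)) + K := by gcongr
      _ = θ' * (|e n| / w n + |e (n + 2)| / w (n + 2)) + K := by ring
  have hgrow' : (fun n => |e n| / w n) =o[atTop] fun n => (2 * θ')⁻¹ ^ n := by
    have hr : 1 < (2 * θ')⁻¹ := (one_lt_inv₀ (by positivity)).2 (by linarith)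
    refine ((hgrow _ hr).abs_left.mul_isBigO (isBigO_refl (fun n => (w n)⁻¹) _)).congr'
      (.of_forall fun n => (div_eq_mul_inv _ _).symm) ?_
    filter_upwards [hw] with n hn
    field_simp
  obtain ⟨N, hN⟩ := eventually_atTop.1 hrec
  refine IsBigO.of_bound (max (max (|e N| / w N) 0) (K / (1 - 2 * θ'))) ?_
  filter_upwards [eventually_ge_atTop N, hw] with n hn hwn
  rw [Real.norm_eq_abs, Real.norm_of_nonneg hwn.le, ← div_le_iff₀ hwn]
  exact le_max_of_le_mul_neighbors_add hθ'0 hθ' hN hgrow' hn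

lemma isLittleO_rpow_rpow_mul_pow {r : ℝ} (hr : 1 < r) (a c : ℝ) :
    (fun n : ℕ => (n : ℝ) ^ c) =o[atTop] fun n : ℕ => (n : ℝ) ^ a * r ^ n := by
  have hexp := (isLittleO_rpow_exp_pos_mul_atTop (c - a) (Real.log_pos hr)).comp_tendsto
    tendsto_natCast_atTop_atTop
  refine ((isBigO_refl (fun n : ℕ => (n : ℝ) ^ a) atTop).mul_isLittleO hexp).congr' ?_ ?_
  · filter_upwards [eventually_gt_atTop 0] with n hn
    rw [Function.comp_apply, ← Real.rpow_add (Nat.cast_pos.2 hn), add_sub_cancel]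
  · refine .of_forall fun n => ?_
    simp only [Function.comp_apply]
    rw [mul_comm (Real.log r), Real.exp_nat_mul, Real.exp_log (zero_lt_one.trans hr)]

lemma tendsto_rpow_natCast_succ_div_rpow (a : ℝ) :
    Tendsto (fun n : ℕ => ((n + 1 : ℕ) : ℝ) ^ a / (n : ℝ) ^ a) atTop (𝓝 1) := by
  have h := (tendsto_natCast_add_div_natCast_add 1 0).rpow_const (p := a) (.inl one_ne_zero)
  rw [Real.one_rpow] at h
  refine h.congr fun n => ?_
  rw [add_zero, Real.div_rpow (by positivity) (by positivity), Nat.cast_add_one]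

section Comparison

variable {t s a : ℝ} {b f : ℕ → ℝ}

lemma tendsto_natCast_add_div_sqrt {c : ℝ} (hb : Tendsto (fun n : ℕ => b n / √n) atTop (𝓝 c))
    (m : ℕ) : Tendsto (fun n : ℕ => b (n + m) / √((n : ℝ) + 1)) atTop (𝓝 c) := by
  have h := (hb.comp (tendsto_add_atTop_nat m)).mul
    (tendsto_sqrt_natCast_add_div_sqrt_natCast_add m.cast_nonneg 1)
  rw [mul_one] at h
  refine h.congr' ?_
  filter_upwards [eventually_gt_atTop 0] with n hn
  rw [Function.comp_apply, Nat.cast_add, div_mul_div_cancel₀ (by positivity)]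

-- The linearisation of the string equation at `f` has the neighbour coefficients `4 f (n + 1)`
-- against the diagonal coefficient on the left, asymptotically four times as large.
lemma mul_abs_sub_le_abs_stringResidual (hs : ∀ n, stringResidual t b n = 0) {n : ℕ}
    (hf : 0 ≤ f (n + 1))
    (hD : 0 ≤ 4 * (b n + b (n + 1) + b (n + 2) + f (n + 1)) - 2 * t) :
    (4 * (b n + b (n + 1) + b (n + 2) + f (n + 1)) - 2 * t) * |b (n + 1) - f (n + 1)| ≤
      4 * f (n + 1) * (|b n - f n| + |b (n + 2) - f (n + 2)|) + |stringResidual t f n| := by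
  have hid : (4 * (b n + b (n + 1) + b (n + 2) + f (n + 1)) - 2 * t) * (b (n + 1) - f (n + 1)) =
      -(4 * f (n + 1) * ((b n - f n) + (b (n + 2) - f (n + 2)))) - stringResidual t f n := by
    have hres := hs n
    rw [stringResidual] at hres ⊢
    linear_combination hres
  rw [← abs_of_nonneg hD, ← abs_mul, hid]
  refine (abs_sub _ _).trans ?_
  rw [abs_neg, abs_mul, abs_of_nonneg (mul_nonneg zero_le_four hf)]
  gcongr
  exact abs_add_le _ _

lemma tendsto_linearization_div_sqrt (hb : Tendsto (fun n : ℕ => b n / √n) atTop (𝓝 s))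
    (hf : Tendsto (fun n : ℕ => f n / √n) atTop (𝓝 s)) :
    Tendsto (fun n : ℕ => (4 * (b n + b (n + 1) + b (n + 2) + f (n + 1)) - 2 * t) /
      √((n : ℝ) + 1)) atTop (𝓝 (16 * s)) := by
  have h := ((((tendsto_natCast_add_div_sqrt hb 0).add (tendsto_natCast_add_div_sqrt hb 1)).add
    (tendsto_natCast_add_div_sqrt hb 2)).add (tendsto_natCast_add_div_sqrt hf 1)).const_mul 4
    |>.sub (tendsto_div_sqrt_natCast_add_one (2 * t))
  rw [show 4 * (s + s + s + s) - 0 = 16 * s by ring] at h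
  refine h.congr fun n => ?_
  rw [add_zero]
  ring

lemma eventually_abs_sub_le (hs : ∀ n, stringResidual t b n = 0) (hs0 : 0 < s)
    (hb : Tendsto (fun n : ℕ => b n / √n) atTop (𝓝 s))
    (hf : Tendsto (fun n : ℕ => f n / √n) atTop (𝓝 s)) :
    ∀ᶠ n in atTop, |b (n + 1) - f (n + 1)| ≤
      3 / 10 * (|b n - f n| + |b (n + 2) - f (n + 2)|)
        + (15 * s * √((n : ℝ) + 1))⁻¹ * |stringResidual t f n| := by
  have hf1 := tendsto_natCast_add_div_sqrt hf 1
  filter_upwards [hf1.eventually_const_lt hs0,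
    hf1.eventually_lt_const (show s < 9 / 8 * s by linarith),
    (tendsto_linearization_div_sqrt (t := t) hb hf).eventually_const_lt
      (show 15 * s < 16 * s by linarith)] with n hfpos hfle hDge
  have hq : 0 < √((n : ℝ) + 1) := by positivity
  rw [lt_div_iff₀ hq] at hfpos hDge
  rw [div_lt_iff₀ hq] at hfle
  have hsq : 0 < 15 * s * √((n : ℝ) + 1) := by positivity
  have hlin := mul_abs_sub_le_abs_stringResidual hs (f := f) (n := n) (by linarith)
    (hsq.trans hDge).le
  set D := 4 * (b n + b (n + 1) + b (n + 2) + f (n + 1)) - 2 * t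
  have hD : 0 < D := hsq.trans hDge
  have hcoeff : 4 * f (n + 1) / D ≤ 3 / 10 := by
    rw [div_le_iff₀ hD]
    linarith
  calc |b (n + 1) - f (n + 1)|
      ≤ (4 * f (n + 1) * (|b n - f n| + |b (n + 2) - f (n + 2)|) + |stringResidual t f n|) / D :=
        (le_div_iff₀' hD).2 hlin
    _ = 4 * f (n + 1) / D * (|b n - f n| + |b (n + 2) - f (n + 2)|)
        + D⁻¹ * |stringResidual t f n| := by ring
    _ ≤ _ := by gcongr

lemma isBigO_sub_of_stringResidual_isBigO (hs : ∀ n, stringResidual t b n = 0) (hs0 : 0 < s)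
    (hb : Tendsto (fun n : ℕ => b n / √n) atTop (𝓝 s))
    (hf : Tendsto (fun n : ℕ => f n / √n) atTop (𝓝 s))
    (hR : stringResidual t f =O[atTop] fun n : ℕ => ((n : ℝ) + 1) ^ (a + 1 / 2)) :
    (fun n => b n - f n) =O[atTop] fun n : ℕ => (n : ℝ) ^ a := by
  refine isBigO_of_abs_le_mul_neighbors (by norm_num) (by norm_num) ?_
    (tendsto_rpow_natCast_succ_div_rpow a) (fun r hr => ?_)
    (eventually_abs_sub_le hs hs0 hb hf) ?_
  · filter_upwards [eventually_gt_atTop 0] with n hn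
    positivity
  · simp only [Real.sqrt_eq_rpow] at hb hf
    exact ((isBigO_atTop_natCast_rpow_of_tendsto_div_rpow hb).sub
      (isBigO_atTop_natCast_rpow_of_tendsto_div_rpow hf)).trans_isLittleO
        (isLittleO_rpow_rpow_mul_pow hr a _)
  · refine (((isBigO_refl (fun n : ℕ => (√((n : ℝ) + 1))⁻¹) atTop).mul hR.abs_left).const_mul_left
      (15 * s)⁻¹).congr (fun n => ?_) fun n => ?_
    · rw [mul_inv (15 * s), mul_assoc]
    · rw [Real.sqrt_eq_rpow, Nat.cast_add_one, Real.rpow_add (by positivity), mul_comm,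
        mul_inv_cancel_right₀ (by positivity)]

end Comparison

/-! ### Second differences and the truncated series -/

lemma isBigO_one_add_rpow_sub (a : ℝ) :
    (fun u : ℝ => (1 + u) ^ a - (1 + a * u + a * (a - 1) / 2 * u ^ 2 + Ring.choose a 3 * u ^ 3))
      =O[𝓝 0] fun u => u ^ 4 := by
  have h := (Real.one_add_rpow_hasFPowerSeriesAt_zero (a := a)).isBigO_sub_partialSum_pow 4
  simp only [zero_add, Real.norm_eq_abs, ← abs_pow] at h
  have hchoose : Ring.choose a 2 = a * (a - 1) / 2 := by
    simp [Ring.choose_eq_smul, descPochhammer_succ_right, smeval_mul, smeval_sub, div_eq_inv_mul]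
  refine h.of_abs_right.congr_left fun u => ?_
  simp [FormalMultilinearSeries.partialSum, Finset.sum_range_succ, binomialSeries,
    FormalMultilinearSeries.coeff_ofScalars, hchoose]
  ring

-- The odd terms of the binomial expansions at `x⁻¹` and `-x⁻¹` cancel.
lemma isBigO_rpow_second_difference_sub (a : ℝ) :
    (fun x : ℝ => (x + 1) ^ a + (x - 1) ^ a - 2 * x ^ a - a * (a - 1) * x ^ (a - 2))
      =O[atTop] fun x => x ^ (a - 4) := by
  have hexp := isBigO_one_add_rpow_sub a
  have hplus := hexp.comp_tendsto tendsto_inv_atTop_zero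
  have hminus := hexp.comp_tendsto (neg_zero (G := ℝ) ▸ tendsto_inv_atTop_zero.neg)
  have hsum := (isBigO_refl (fun x : ℝ => x ^ a) atTop).mul
    (hplus.add (hminus.congr_right fun x => Even.neg_pow (by decide) x⁻¹))
  refine hsum.congr' ?_ ?_
  · filter_upwards [eventually_gt_atTop 1] with x hx
    have hx0 : 0 < x := zero_lt_one.trans hx
    have hadd : (x + 1) ^ a = x ^ a * (1 + x⁻¹) ^ a := by
      rw [← Real.mul_rpow hx0.le (by positivity), mul_one_add, mul_inv_cancel₀ hx0.ne']
    have hsub : (x - 1) ^ a = x ^ a * (1 + -x⁻¹) ^ a := by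
      rw [← sub_eq_add_neg, ← Real.mul_rpow hx0.le (sub_nonneg.2 (inv_le_one_of_one_le₀ hx.le)),
        mul_one_sub, mul_inv_cancel₀ hx0.ne']
    have hpow : x ^ (a - 2) = x ^ a / x ^ 2 := mod_cast Real.rpow_sub_natCast hx0.ne' a 2
    rw [hadd, hsub, hpow]
    simp only [Function.comp_apply]
    ring
  · filter_upwards [eventually_gt_atTop 0] with x hx
    have hpow : x ^ (a - 4) = x ^ a / x ^ 4 := mod_cast Real.rpow_sub_natCast hx.ne' a 4
    rw [hpow, Function.comp_apply, inv_pow, div_eq_mul_inv]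

lemma isBigO_rpow_rpow_atTop {a b : ℝ} (h : a ≤ b) :
    (fun x : ℝ => x ^ a) =O[atTop] fun x => x ^ b := by
  refine IsBigO.of_bound 1 ?_
  filter_upwards [eventually_ge_atTop 1] with x hx
  rw [one_mul, Real.norm_of_nonneg (by positivity), Real.norm_of_nonneg (by positivity)]
  exact Real.rpow_le_rpow_of_exponent_le hx h

lemma isBigO_rpow_second_difference (a : ℝ) :
    (fun x : ℝ => (x + 1) ^ a + (x - 1) ^ a - 2 * x ^ a) =O[atTop] fun x => x ^ (a - 2) := by
  have h := ((isBigO_rpow_second_difference_sub a).trans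
    (isBigO_rpow_rpow_atTop (by linarith : a - 4 ≤ a - 2))).add
    ((isBigO_refl (fun x : ℝ => x ^ (a - 2)) atTop).const_mul_left (a * (a - 1)))
  exact h.congr_left fun x => sub_add_cancel _ _

/-- The asymptotic series of the recurrence coefficients at the index `x`, truncated after the
term of order `x⁻³`. The index is real so that it can be expanded in powers of `x`. -/
noncomputable def freudApprox (t x : ℝ) : ℝ :=
  x ^ (1 / 2 : ℝ) / (2 * √3)
    + t / 12
    + t ^ 2 / (48 * √3 * x ^ (1 / 2 : ℝ))
    - (t ^ 4 - 48) / (2304 * √3 * x ^ (3 / 2 : ℝ))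
    + t / (288 * x ^ 2)
    + t ^ 2 * (t ^ 4 - 144) / (55296 * √3 * x ^ (5 / 2 : ℝ))
    - t ^ 3 / (1728 * x ^ 3)

lemma freudApprox_eq_sum_rpow (t : ℝ) {x : ℝ} (hx : 0 ≤ x) :
    freudApprox t x = 1 / (2 * √3) * x ^ (1 / 2 : ℝ) + t / 12
      + t ^ 2 / (48 * √3) * x ^ (-(1 / 2) : ℝ)
      + -((t ^ 4 - 48) / (2304 * √3)) * x ^ (-(3 / 2) : ℝ)
      + t / 288 * x ^ (-2 : ℝ)
      + t ^ 2 * (t ^ 4 - 144) / (55296 * √3) * x ^ (-(5 / 2) : ℝ)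
      + -(t ^ 3 / 1728) * x ^ (-3 : ℝ) := by
  simp only [freudApprox, Real.rpow_neg hx, Real.rpow_ofNat, div_eq_mul_inv, mul_inv]
  ring

lemma isBigO_freudApprox_second_difference_sub (t : ℝ) :
    (fun x : ℝ => freudApprox t (x + 1) + freudApprox t (x - 1) - 2 * freudApprox t x
      - (-1 / (8 * √3 * x ^ (3 / 2 : ℝ)) + t ^ 2 / (64 * √3 * x ^ (5 / 2 : ℝ))))
      =O[atTop] fun x => x ^ (-(7 / 2) : ℝ) := by
  have hmain (c a : ℝ) (ha : a - 4 ≤ -(7 / 2)) :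
      (fun x : ℝ => c * ((x + 1) ^ a + (x - 1) ^ a - 2 * x ^ a - a * (a - 1) * x ^ (a - 2)))
        =O[atTop] fun x => x ^ (-(7 / 2) : ℝ) :=
    ((isBigO_rpow_second_difference_sub a).trans (isBigO_rpow_rpow_atTop ha)).const_mul_left c
  have hsmall (c a : ℝ) (ha : a - 2 ≤ -(7 / 2)) :
      (fun x : ℝ => c * ((x + 1) ^ a + (x - 1) ^ a - 2 * x ^ a))
        =O[atTop] fun x => x ^ (-(7 / 2) : ℝ) :=
    ((isBigO_rpow_second_difference a).trans (isBigO_rpow_rpow_atTop ha)).const_mul_left c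
  have hsum := (((((hmain (1 / (2 * √3)) (1 / 2) (by norm_num)).add
    (hmain (t ^ 2 / (48 * √3)) (-(1 / 2)) (by norm_num))).add
    (hsmall (-((t ^ 4 - 48) / (2304 * √3))) (-(3 / 2)) (by norm_num))).add
    (hsmall (t / 288) (-2) (by norm_num))).add
    (hsmall (t ^ 2 * (t ^ 4 - 144) / (55296 * √3)) (-(5 / 2)) (by norm_num))).add
    (hsmall (-(t ^ 3 / 1728)) (-3) (by norm_num))
  refine hsum.congr' ?_ EventuallyEq.rfl
  filter_upwards [eventually_ge_atTop 1] with x hx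
  have hx0 : 0 ≤ x := zero_le_one.trans hx
  rw [freudApprox_eq_sum_rpow t (by linarith : 0 ≤ x + 1),
    freudApprox_eq_sum_rpow t (sub_nonneg.2 hx), freudApprox_eq_sum_rpow t hx0,
    show (1 / 2 - 2 : ℝ) = -(3 / 2) by norm_num, show (-(1 / 2) - 2 : ℝ) = -(5 / 2) by norm_num]
  simp only [Real.rpow_neg hx0, div_eq_mul_inv, mul_inv]
  ring

section Substitution

variable {y : ℝ}

lemma one_div_three_mul_sq_rpow (hy : 0 < y) (k : ℕ) :
    (1 / (3 * y ^ 2)) ^ (k + 1 / 2 : ℝ) = 1 / (√3 * 3 ^ k * y ^ (2 * k + 1)) := by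
  rw [Real.rpow_add (by positivity), Real.rpow_natCast, ← Real.sqrt_eq_rpow,
    Real.sqrt_div' _ (by positivity), Real.sqrt_one, Real.sqrt_mul zero_le_three,
    Real.sqrt_sq hy.le, div_pow, one_pow, mul_pow, ← pow_mul, pow_succ]
  field_simp

lemma one_div_three_mul_sq_rpow_halves (hy : 0 < y) :
    (1 / (3 * y ^ 2)) ^ (1 / 2 : ℝ) = 1 / (√3 * y) ∧
    (1 / (3 * y ^ 2)) ^ (3 / 2 : ℝ) = 1 / (√3 * 3 * y ^ 3) ∧
    (1 / (3 * y ^ 2)) ^ (5 / 2 : ℝ) = 1 / (√3 * 9 * y ^ 5) := by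
  have h0 := one_div_three_mul_sq_rpow hy 0
  have h1 := one_div_three_mul_sq_rpow hy 1
  have h2 := one_div_three_mul_sq_rpow hy 2
  norm_num at h0 h1 h2 ⊢
  exact ⟨h0, h1, h2⟩

-- The substitution `x = 1 / (3 y²)` makes all the coefficients rational.
lemma freudApprox_one_div_three_mul_sq (t : ℝ) (hy : 0 < y) :
    freudApprox t (1 / (3 * y ^ 2)) = 1 / (6 * y) + t / 12 + t ^ 2 * y / 48
      - (t ^ 4 - 48) * y ^ 3 / 768 + t * y ^ 4 / 32 + t ^ 2 * (t ^ 4 - 144) * y ^ 5 / 6144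
      - t ^ 3 * y ^ 6 / 64 := by
  obtain ⟨h1, h3, h5⟩ := one_div_three_mul_sq_rpow_halves hy
  rw [freudApprox, h1, h3, h5]
  field_simp
  rw [Real.sq_sqrt zero_le_three]
  ring

lemma freudApprox_residual_one_div_three_mul_sq (t : ℝ) (hy : 0 < y) :
    4 * freudApprox t (1 / (3 * y ^ 2)) * (3 * freudApprox t (1 / (3 * y ^ 2))
        + (-1 / (8 * √3 * (1 / (3 * y ^ 2)) ^ (3 / 2 : ℝ))
          + t ^ 2 / (64 * √3 * (1 / (3 * y ^ 2)) ^ (5 / 2 : ℝ))) - t / 2) - 1 / (3 * y ^ 2) =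
      y ^ 6 * (-3 / 64 + 5 * t ^ 8 / 49152 - 9 * t ^ 5 * y / 1024
        + (3 * t ^ 2 / 64 - t ^ 10 / 196608) * y ^ 2 + 5 * t ^ 7 * y ^ 3 / 8192
        + (t ^ 12 / 3145728 - 75 * t ^ 4 / 4096) * y ^ 4 - t ^ 9 * y ^ 5 / 16384
        + 3 * t ^ 6 * y ^ 6 / 1024) := by
  obtain ⟨-, h3, h5⟩ := one_div_three_mul_sq_rpow_halves hy
  rw [freudApprox_one_div_three_mul_sq t hy, h3, h5]
  field_simp
  ring

end Substitution

lemma tendsto_inv_sqrt_three_mul : Tendsto (fun x : ℝ => (√(3 * x))⁻¹) atTop (𝓝 0) :=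
  (Real.tendsto_sqrt_atTop.comp (tendsto_id.const_mul_atTop zero_lt_three)).inv_tendsto_atTop

lemma one_div_three_mul_inv_sqrt_three_mul_sq {x : ℝ} (hx : 0 ≤ x) :
    1 / (3 * (√(3 * x))⁻¹ ^ 2) = x := by
  rw [inv_pow, Real.sq_sqrt (by positivity)]
  field_simp

lemma tendsto_freudApprox_div_sqrt (t : ℝ) :
    Tendsto (fun x : ℝ => freudApprox t x / √x) atTop (𝓝 (1 / (2 * √3))) := by
  have hcont : Continuous fun y : ℝ => √3 * (1 / 6 + t * y / 12 + t ^ 2 * y ^ 2 / 48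
      - (t ^ 4 - 48) * y ^ 4 / 768 + t * y ^ 5 / 32 + t ^ 2 * (t ^ 4 - 144) * y ^ 6 / 6144
      - t ^ 3 * y ^ 7 / 64) := by fun_prop
  have hlim := (hcont.tendsto 0).comp tendsto_inv_sqrt_three_mul
  rw [show 1 / (2 * √3) = √3 * (1 / 6) by field_simp; norm_num]
  refine (hlim.congr' ?_).trans_eq (by norm_num)
  filter_upwards [eventually_gt_atTop 0] with x hx
  have hy : 0 < (√(3 * x))⁻¹ := by positivity
  have hsqrt : √x = 1 / (√3 * (√(3 * x))⁻¹) := by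
    rw [Real.sqrt_mul zero_le_three]
    field_simp
  have happrox := freudApprox_one_div_three_mul_sq t hy
  rw [one_div_three_mul_inv_sqrt_three_mul_sq hx.le] at happrox
  rw [happrox, hsqrt, Function.comp_apply]
  field_simp

lemma isBigO_freudApprox_residual_main (t : ℝ) :
    (fun x : ℝ => 4 * freudApprox t x * (3 * freudApprox t x
      + (-1 / (8 * √3 * x ^ (3 / 2 : ℝ)) + t ^ 2 / (64 * √3 * x ^ (5 / 2 : ℝ))) - t / 2) - x)
      =O[atTop] fun x => x ^ (-3 : ℝ) := by
  have hcont : Continuous fun y : ℝ => 1 / 27 * (-3 / 64 + 5 * t ^ 8 / 49152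
      - 9 * t ^ 5 * y / 1024 + (3 * t ^ 2 / 64 - t ^ 10 / 196608) * y ^ 2
      + 5 * t ^ 7 * y ^ 3 / 8192 + (t ^ 12 / 3145728 - 75 * t ^ 4 / 4096) * y ^ 4
      - t ^ 9 * y ^ 5 / 16384 + 3 * t ^ 6 * y ^ 6 / 1024) := by fun_prop
  have hlim := (hcont.tendsto 0).comp tendsto_inv_sqrt_three_mul
  refine ((isBigO_refl (fun x : ℝ => x ^ (-3 : ℝ)) atTop).mul (hlim.isBigO_one ℝ)).congr' ?_
    (.of_forall fun x => mul_one _)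
  filter_upwards [eventually_gt_atTop 0] with x hx
  have hx3 : x ^ (-3 : ℝ) = 27 * (√(3 * x))⁻¹ ^ 6 := by
    rw [inv_pow, pow_mul _ 2 3, Real.sq_sqrt (by positivity), Real.rpow_neg hx.le,
      Real.rpow_ofNat, mul_pow]
    field_simp
    norm_num
  have hres := freudApprox_residual_one_div_three_mul_sq t (y := (√(3 * x))⁻¹) (by positivity)
  rw [one_div_three_mul_inv_sqrt_three_mul_sq hx.le] at hres
  rw [hres, hx3, Function.comp_apply]
  ring

lemma isBigO_freudApprox_residual (t : ℝ) :
    (fun x : ℝ => 4 * freudApprox t x * (freudApprox t (x - 1) + freudApprox t x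
      + freudApprox t (x + 1)) - 2 * t * freudApprox t x - x)
      =O[atTop] fun x => x ^ (-3 : ℝ) := by
  have hgrowth : freudApprox t =O[atTop] fun x : ℝ => x ^ (1 / 2 : ℝ) := by
    simp only [← Real.sqrt_eq_rpow]
    refine isBigO_of_div_tendsto_nhds ?_ _ (tendsto_freudApprox_div_sqrt t)
    filter_upwards [eventually_gt_atTop 0] with x hx h
    exact absurd h (by positivity)
  have herr := (hgrowth.const_mul_left 4).mul_atTop_rpow_of_isBigO_rpow _ _ (-3)
    (isBigO_freudApprox_second_difference_sub t) (by norm_num)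
  refine ((isBigO_freudApprox_residual_main t).add herr).congr_left fun x => ?_
  rw [Pi.mul_apply]
  ring

lemma isBigO_stringResidual_freudApprox (t : ℝ) :
    stringResidual t (fun n => freudApprox t n) =O[atTop]
      fun n : ℕ => ((n : ℝ) + 1) ^ (-3 : ℝ) := by
  have hshift : Tendsto (fun n : ℕ => (n : ℝ) + 1) atTop atTop :=
    tendsto_atTop_add_const_right _ _ tendsto_natCast_atTop_atTop
  refine ((isBigO_freudApprox_residual t).comp_tendsto hshift).congr_left fun n => ?_
  simp only [Function.comp_apply, stringResidual]
  push_cast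
  rw [add_sub_cancel_right, add_assoc (n : ℝ) 1 1, one_add_one_eq_two]

theorem theorem1 (t : ℝ) :
    (∃! β : ℕ → ℝ, IsFreudRecurrenceCoeff t β) ∧
    ∀ β : ℕ → ℝ, IsFreudRecurrenceCoeff t β →
      (fun n : ℕ => β n -
        ((n : ℝ) ^ (1 / 2 : ℝ) / (2 * √3)
          + t / 12
          + t ^ 2 / (48 * √3 * (n : ℝ) ^ (1 / 2 : ℝ))
          - (t ^ 4 - 48) / (2304 * √3 * (n : ℝ) ^ (3 / 2 : ℝ))
          + t / (288 * (n : ℝ) ^ 2)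
          + t ^ 2 * (t ^ 4 - 144) / (55296 * √3 * (n : ℝ) ^ (5 / 2 : ℝ))
          - t ^ 3 / (1728 * (n : ℝ) ^ 3)))
        =O[atTop] (fun n : ℕ => (n : ℝ) ^ (-(7 / 2) : ℝ)) := by
  refine ⟨existsUnique_isFreudRecurrenceCoeff t, fun β hβ => ?_⟩
  have hstring := hβ.stringResidual_eq_zero
  have hlead := tendsto_div_sqrt_of_stringResidual_eq_zero hβ.nonneg hstring
  have hseries := (tendsto_freudApprox_div_sqrt t).comp tendsto_natCast_atTop_atTop
  have hresidual := isBigO_stringResidual_freudApprox t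
  rw [show (-3 : ℝ) = -(7 / 2) + 1 / 2 by norm_num] at hresidual
  exact isBigO_sub_of_stringResidual_isBigO hstring (by positivity) hlead hseries hresidual
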